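/- Let $m \ge 1$ be an integer, $f = 2m+1$, $q = 2^{f}$, and let $\sigma$ be the automorphism $\xi \mapsto \xi^{2^{m+1}}$ of $\mathbb{F}_q$. Let $$\Delta = \{(\eta_1,\eta_2,\eta_3) \in \mathbb{F}_q^3 : \eta_3 = \eta_1\eta_2 + \eta_1^{\sigma+2} + \eta_2^{\sigma}\} \cup \{\infty\}$$ be the Suzuki ovoid (where $\eta^{\sigma+k}$ means $\eta^{\sigma}\eta^{k}$), and let $G_0 = {}^2B_2(q)$ be the group of permutations of $\Delta$ generated by - the permutations $t_{\alpha,\beta}$ ($\alpha,\beta \in \mathbb{F}_q$) that fix $\infty$ and map $(\eta_1,\eta_2,\eta_3)$ to $(\eta_1+\alpha,\ \eta_2+\beta+\alpha^{\sigma}\eta_1,\ \eta_3+\alpha\beta+\alpha^{\sigma+2}+\beta^{\sigma}+\alpha\eta_2+\alpha^{\sigma+1}\eta_1+\beta\eta_1)$, - the permutations $n_\gamma$ ($\gamma \in \mathbb{F}_q\setminus\{0\}$) that fix $\infty$ and map $(\eta_1,\eta_2,\eta_3)$ to $(\gamma\eta_1,\ \gamma^{\sigma+1}\eta_2,\ \gamma^{\sigma+2}\eta_3)$,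 - the involution $w$ that exchanges $\infty$ and $(0,0,0)$ and maps $(\eta_1,\eta_2,\eta_3)$ to $(\eta_2/\eta_3,\ \eta_1/\eta_3,\ 1/\eta_3)$ if $\eta_3 \ne 0$. The group $\mathrm{Aut}(\mathbb{F}_q)$ acts on $\Delta$ coordinatewise, fixing $\infty$, and normalizes $G_0$. Let $G = G_0 \rtimes \mathrm{Aut}(\mathbb{F}_q)$, with the induced action on $\Delta$, and let $\Omega$ be the set of the $2$-element subsets of $\Delta$, with the induced action of $G$. A sequence $(\omega_1,\dots,\omega_\ell)$ of elements of $\Omega$ is an irredundant base for $G$ if all the inclusions in the chain of pointwise stabilizers $G \ge G_{\omega_1} \ge G_{\omega_1,\omega_2} \ge \dots \ge G_{\omega_1,\dots,\omega_\ell}$ are strict and $G_{\omega_1,\dots,\omega_\ell} = 1$. Let $\mathcal{I}(G,\Omega)$ be the set of all $\ell \in \mathbb{N}$ such that $G$ has an irredundant base of length $\ell$ in its action on $\Omega$. Then $$\mathcal{I}(G,\Omega) = \{2,3,\dots,3+\pi(f)\},$$ where $\pi(f)$ is the number of prime divisors of $f$, counted with multiplicity. -/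

import Mathlib

/-- The tuple `ω = (ω₁, …, ω_ℓ)` is an irredundant base for the action of `G` on `Ω`: all the
inclusions in the chain `G ≥ G_{ω₁} ≥ G_{ω₁,ω₂} ≥ ⋯ ≥ G_{ω₁,…,ω_ℓ}` of pointwise stabilizers
are strict, and the last term of the chain is the identity. -/
structure IsIrredundantBase (G : Type*) {Ω : Type*} [Group G] [MulAction G Ω] {ℓ : ℕ}
    (ω : Fin ℓ → Ω) : Prop where
  strict : ∀ i : Fin ℓ,
    fixingSubgroup G (ω '' Set.Iic i) < fixingSubgroup G (ω '' Set.Iio i)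
  trivial : fixingSubgroup G (Set.range ω) = ⊥

/-- `𝓘(G, Ω)`: the set of cardinalities of the irredundant bases for `G` acting on `Ω`. -/
def irredundantBaseSizes (G Ω : Type*) [Group G] [MulAction G Ω] : Set ℕ :=
  {ℓ | ∃ ω : Fin ℓ → Ω, IsIrredundantBase G ω}

namespace Suzuki

noncomputable section

/-- The field with `q = 2 ^ (2 * m + 1)` elements. -/
abbrev Fq (m : ℕ) : Type := GaloisField 2 (2 * m + 1)

/-- The automorphism `σ : ξ ↦ ξ ^ (2 ^ (m + 1))` of the field with `2 ^ (2 * m + 1)` elements. -/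
def sigma (m : ℕ) : Fq m ≃+* Fq m := iterateFrobeniusEquiv (Fq m) 2 (m + 1)

theorem sigma_apply {m : ℕ} (x : Fq m) : sigma m x = x ^ 2 ^ (m + 1) := rfl

theorem sigma_sigma {m : ℕ} (x : Fq m) : sigma m (sigma m x) = x ^ 2 := by
  have : Fintype (Fq m) := Fintype.ofFinite _
  have hc : Fintype.card (Fq m) = 2 ^ (2 * m + 1) := by
    rw [← Nat.card_eq_fintype_card, GaloisField.card 2 _ (by omega)]
  have h : x ^ 2 ^ (2 * m + 1) = x := by rw [← hc, FiniteField.pow_card]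
  rw [sigma_apply, sigma_apply, ← pow_mul, ← pow_add,
    show m + 1 + (m + 1) = (2 * m + 1) + 1 by omega, pow_succ, pow_mul, h]

theorem two_eq_zero (m : ℕ) : (2 : Fq m) = 0 := CharTwo.two_eq_zero

/-- The affine part of the Suzuki ovoid: the triples `(x, y, z)` with
`z = x y + x ^ (σ + 2) + y ^ σ`. -/
@[ext]
structure AffinePoint (m : ℕ) : Type where
  x : Fq m
  y : Fq m
  z : Fq m
  eqn : z = x * y + sigma m x * x ^ 2 + sigma m y

/-- The Suzuki ovoid `Δ`; the point `∞` is `none`. -/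
abbrev Ovoid (m : ℕ) : Type := Option (AffinePoint m)

theorem AffinePoint.ext' {m : ℕ} {p p' : AffinePoint m} (hx : p.x = p'.x) (hy : p.y = p'.y) :
    p = p' := by
  refine AffinePoint.ext hx hy ?_
  rw [p.eqn, p'.eqn, hx, hy]

/-- The affine point `(0, 0, 0)`. -/
def origin (m : ℕ) : AffinePoint m := ⟨0, 0, 0, by simp⟩

theorem AffinePoint.eq_origin {m : ℕ} {p : AffinePoint m} (h : p.z = 0) : p = origin m := by
  obtain ⟨x, y, z, e⟩ := p
  have e : z = x * y + sigma m x * x ^ 2 + sigma m y := e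
  have h : z = 0 := h
  rw [h] at e
  have h2 := two_eq_zero m
  by_cases hx : x = 0
  · subst hx
    have hy : y = 0 := by simpa using e.symm
    exact AffinePoint.ext' rfl hy
  · exfalso
    have hs : sigma m x ≠ 0 := by simpa using hx
    obtain ⟨u, hu⟩ : ∃ u, y = x * sigma m x * u := ⟨y / (x * sigma m x), by field_simp⟩
    subst hu
    simp only [map_mul, sigma_sigma] at e
    have e1 : u + 1 + sigma m u = 0 := by
      have : x ^ 2 * sigma m x * (u + 1 + sigma m u) = 0 := by linear_combination -e
      simpa [hx, hs] using this
    have e2 : sigma m u + 1 + u ^ 2 = 0 := by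
      have := congrArg (sigma m) e1
      simpa [sigma_sigma] using this
    have e3 : u * (u - 1) = 0 := by linear_combination e2 - e1
    rcases mul_eq_zero.mp e3 with h | h
    · subst h
      simp at e1
    · have hu : u = 1 := sub_eq_zero.mp h
      subst hu
      rw [map_one] at e1
      exact one_ne_zero (α := Fq m) (by linear_combination e1 - h2)

/-- `t_{α,β}` on affine points. -/
def tFun {m : ℕ} (α β : Fq m) (p : AffinePoint m) : AffinePoint m where
  x := p.x + α
  y := p.y + β + sigma m α * p.x
  z := p.z + α * β + sigma m α * α ^ 2 + sigma m β + α * p.y + sigma m α * α * p.x + β * p.x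
  eqn := by
    have h2 := two_eq_zero m
    have e := p.eqn
    simp only [map_add, map_mul, sigma_sigma]
    linear_combination e - (sigma m α * p.x ^ 2 + sigma m p.x * α * p.x + sigma m p.x * α ^ 2
      + sigma m α * α * p.x) * h2

theorem tFun_tFun {m : ℕ} (α β γ : Fq m) (h : β + γ + sigma m α * α = 0) (p : AffinePoint m) :
    tFun α β (tFun α γ p) = p := by
  have h2 := two_eq_zero m
  refine AffinePoint.ext' ?_ ?_
  · simp only [tFun]
    linear_combination α * h2
  · simp only [tFun]
    linear_combination h + sigma m α * p.x * h2

/-- The permutation `t_{α,β}` of the ovoid; it fixes `∞`. -/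
def t {m : ℕ} (α β : Fq m) : Equiv.Perm (Ovoid m) :=
  Equiv.optionCongr
    { toFun := tFun α β
      invFun := tFun α (β + sigma m α * α)
      left_inv := tFun_tFun α _ _ (by
        linear_combination (β + sigma m α * α) * two_eq_zero m)
      right_inv := tFun_tFun α _ _ (by
        linear_combination (β + sigma m α * α) * two_eq_zero m) }

/-- `n_γ` on affine points. -/
def nFun {m : ℕ} (γ : (Fq m)ˣ) (p : AffinePoint m) : AffinePoint m where
  x := γ * p.x
  y := sigma m γ * γ * p.y
  z := sigma m γ * γ ^ 2 * p.z
  eqn := by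
    have e := p.eqn
    simp only [map_mul, sigma_sigma]
    linear_combination sigma m γ * γ ^ 2 * e

theorem nFun_nFun {m : ℕ} (γ δ : (Fq m)ˣ) (h : γ * δ = 1) (p : AffinePoint m) :
    nFun γ (nFun δ p) = p := by
  have h' : (γ : Fq m) * δ = 1 := by rw [← Units.val_mul, h, Units.val_one]
  have hs : sigma m γ * sigma m δ = 1 := by rw [← map_mul, h', map_one]
  refine AffinePoint.ext' ?_ ?_
  · simp only [nFun]
    linear_combination p.x * h'
  · simp only [nFun]
    linear_combination p.y * (γ * δ) * hs + p.y * h'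

/-- The permutation `n_γ` of the ovoid, for `γ ≠ 0`; it fixes `∞`. -/
def n {m : ℕ} (γ : (Fq m)ˣ) : Equiv.Perm (Ovoid m) :=
  Equiv.optionCongr
    { toFun := nFun γ
      invFun := nFun γ⁻¹
      left_inv := nFun_nFun _ _ (inv_mul_cancel γ)
      right_inv := nFun_nFun _ _ (mul_inv_cancel γ) }

/-- The map `(x, y, z) ↦ (y / z, x / z, 1 / z)` on affine points with `z ≠ 0`. -/
def wAffine {m : ℕ} (p : AffinePoint m) (hz : p.z ≠ 0) : AffinePoint m where
  x := p.y / p.z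
  y := p.x / p.z
  z := 1 / p.z
  eqn := by
    obtain ⟨x, y, z, e⟩ := p
    have e : z = x * y + sigma m x * x ^ 2 + sigma m y := e
    have hz : z ≠ 0 := hz
    have hs : sigma m z ≠ 0 := by simpa using hz
    have es := congrArg (sigma m) e
    simp only [map_add, map_mul, map_pow, sigma_sigma] at es
    have h2 := two_eq_zero m
    simp only [map_div₀]
    field_simp
    rw [es, e]
    linear_combination -(x * y * sigma m x * sigma m y + x ^ 3 * y * sigma m x ^ 2) * h2

/-- `w` as a map of the ovoid to itself; it exchanges `∞` and `(0, 0, 0)`, which is the only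
affine point with vanishing third coordinate (`AffinePoint.eq_origin`). -/
def wFun {m : ℕ} : Ovoid m → Ovoid m
  | none => some (origin m)
  | some p => open Classical in if hz : p.z = 0 then none else some (wAffine p hz)

theorem wFun_involutive (m : ℕ) : Function.Involutive (wFun (m := m)) := by
  rintro (_ | p)
  · simp [wFun, origin]
  · by_cases hz : p.z = 0
    · have h0 : (origin m).z = 0 := rfl
      rw [p.eq_origin hz]
      simp [wFun, h0]
    · have hz' : (wAffine p hz).z ≠ 0 := one_div_ne_zero hz
      simp only [wFun, hz, hz', dite_false]
      refine congrArg some (AffinePoint.ext' ?_ ?_)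
      · simp only [wAffine]
        field_simp
      · simp only [wAffine]
        field_simp

/-- The permutation `w` of the ovoid. -/
def w (m : ℕ) : Equiv.Perm (Ovoid m) := (wFun_involutive m).toPerm

/-- The Suzuki group `G₀ = ²B₂(q)`, `q = 2 ^ (2 * m + 1)`: the group of permutations of the ovoid
generated by `w`, all the `t_{α,β}` and all the `n_γ`. -/
def suzukiGroup (m : ℕ) : Subgroup (Equiv.Perm (Ovoid m)) :=
  Subgroup.closure
    ({w m} ∪ Set.range (fun a : Fq m × Fq m => t a.1 a.2) ∪ Set.range (fun γ : (Fq m)ˣ => n γ))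

theorem map_sigma {m : ℕ} (a : RingAut (Fq m)) (x : Fq m) : a (sigma m x) = sigma m (a x) := by
  simp only [sigma_apply, map_pow]

/-- A field automorphism applied to the coordinates of an affine point. -/
def fieldFun {m : ℕ} (a : RingAut (Fq m)) (p : AffinePoint m) : AffinePoint m where
  x := a p.x
  y := a p.y
  z := a p.z
  eqn := by rw [p.eqn]; simp only [map_add, map_mul, map_pow, map_sigma]

/-- The action of `Aut(F_q)` on the ovoid: coordinatewise, fixing `∞`. -/
def fieldPerm (m : ℕ) : RingAut (Fq m) →* Equiv.Perm (Ovoid m) where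
  toFun a := Equiv.optionCongr
    { toFun := fieldFun a
      invFun := fieldFun a⁻¹
      left_inv := fun p => AffinePoint.ext' (a.symm_apply_apply _) (a.symm_apply_apply _)
      right_inv := fun p => AffinePoint.ext' (a.apply_symm_apply _) (a.apply_symm_apply _) }
  map_one' := by
    ext1 p
    cases p <;> rfl
  map_mul' a b := by
    ext1 p
    cases p <;> rfl

theorem fieldPerm_w {m : ℕ} (a : RingAut (Fq m)) : fieldPerm m a * w m = w m * fieldPerm m a := by
  ext1 p
  rcases p with _ | p
  · change some (fieldFun a (origin m)) = some (origin m)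
    exact congrArg some (AffinePoint.ext' (map_zero a) (map_zero a))
  · change Option.map (fieldFun a) (wFun (some p)) = wFun (some (fieldFun a p))
    have hz : (fieldFun a p).z = 0 ↔ p.z = 0 := by simp [fieldFun]
    by_cases h : p.z = 0
    · simp [wFun, h, hz]
    · have h' := mt hz.mp h
      simp only [wFun, h, h', dite_false, Option.map_some]
      exact congrArg some (AffinePoint.ext' (map_div₀ a _ _) (map_div₀ a _ _))

theorem fieldPerm_t {m : ℕ} (a : RingAut (Fq m)) (α β : Fq m) :
    fieldPerm m a * t α β = t (a α) (a β) * fieldPerm m a := by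
  ext1 p
  rcases p with _ | p
  · rfl
  · change some (fieldFun a (tFun α β p)) = some (tFun (a α) (a β) (fieldFun a p))
    refine congrArg some (AffinePoint.ext' ?_ ?_) <;> simp [fieldFun, tFun, map_sigma]

theorem fieldPerm_n {m : ℕ} (a : RingAut (Fq m)) (γ : (Fq m)ˣ) :
    fieldPerm m a * n γ = n (Units.map (a : Fq m →* Fq m) γ) * fieldPerm m a := by
  ext1 p
  rcases p with _ | p
  · rfl
  · change some (fieldFun a (nFun γ p)) =
      some (nFun (Units.map (a : Fq m →* Fq m) γ) (fieldFun a p))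
    refine congrArg some (AffinePoint.ext' ?_ ?_) <;> simp [fieldFun, nFun, map_sigma]

theorem fieldPerm_conj_mem {m : ℕ} (a : RingAut (Fq m)) {g : Equiv.Perm (Ovoid m)}
    (hg : g ∈ suzukiGroup m) : fieldPerm m a * g * (fieldPerm m a)⁻¹ ∈ suzukiGroup m := by
  have key : suzukiGroup m ≤
      (suzukiGroup m).comap (MulAut.conj (fieldPerm m a)).toMonoidHom := by
    rw [suzukiGroup, Subgroup.closure_le]
    rintro g ((hg | ⟨⟨α, β⟩, rfl⟩) | ⟨γ, rfl⟩)
    · rw [Set.mem_singleton_iff.mp hg]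
      change fieldPerm m a * w m * (fieldPerm m a)⁻¹ ∈ Subgroup.closure _
      rw [fieldPerm_w, mul_inv_cancel_right]
      exact Subgroup.subset_closure (Or.inl (Or.inl rfl))
    · change fieldPerm m a * t α β * (fieldPerm m a)⁻¹ ∈ Subgroup.closure _
      rw [fieldPerm_t, mul_inv_cancel_right]
      exact Subgroup.subset_closure (Or.inl (Or.inr ⟨(a α, a β), rfl⟩))
    · change fieldPerm m a * n γ * (fieldPerm m a)⁻¹ ∈ Subgroup.closure _
      rw [fieldPerm_n, mul_inv_cancel_right]
      exact Subgroup.subset_closure (Or.inr ⟨_, rfl⟩)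
  exact key hg

theorem fieldPerm_mem_normalizer {m : ℕ} (a : RingAut (Fq m)) :
    fieldPerm m a ∈ Subgroup.normalizer (suzukiGroup m : Set (Equiv.Perm (Ovoid m))) := by
  refine Subgroup.mem_normalizer_iff.mpr fun g => ⟨fieldPerm_conj_mem a, fun h => ?_⟩
  have := fieldPerm_conj_mem a⁻¹ h
  rw [map_inv] at this
  simpa [mul_assoc] using this

/-- `Aut(F_q)` acts on `G₀` by conjugation inside the symmetric group of the ovoid. -/
def fieldConj (m : ℕ) : RingAut (Fq m) →* MulAut (suzukiGroup m) :=
  (suzukiGroup m).normalizerMonoidHom.comp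
    ((fieldPerm m).codRestrict _ fieldPerm_mem_normalizer)

theorem coe_fieldConj {m : ℕ} (a : RingAut (Fq m)) (g : suzukiGroup m) :
    (fieldConj m a g : Equiv.Perm (Ovoid m)) = fieldPerm m a * g * (fieldPerm m a)⁻¹ := rfl

/-- The group `G = ²B₂(q) ⋊ Aut(F_q)`, `q = 2 ^ (2 * m + 1)`. -/
abbrev SuzukiAut (m : ℕ) : Type :=
  SemidirectProduct (suzukiGroup m) (RingAut (Fq m)) (fieldConj m)

/-- The action of `G` on the ovoid: `(g, a)` acts as `g` after the coordinatewise action of `a`. -/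
def toPerm (m : ℕ) : SuzukiAut m →* Equiv.Perm (Ovoid m) :=
  SemidirectProduct.lift (suzukiGroup m).subtype (fieldPerm m) fun _ => by
    ext1 g
    rfl

instance (m : ℕ) : MulAction (SuzukiAut m) (Ovoid m) :=
  MulAction.compHom (Ovoid m) (toPerm m)

theorem smul_def {m : ℕ} (g : SuzukiAut m) (p : Ovoid m) :
    g • p = (g.left : Equiv.Perm (Ovoid m)) (fieldPerm m g.right p) := rfl

instance (m : ℕ) : DecidableEq (Ovoid m) := Classical.decEq _

/-- The set `Ω` of the `2`-subsets of the ovoid, with `G` acting by `g • {p, p'} = {g • p, g • p'}`. -/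
abbrev OvoidPairs (m : ℕ) : Type := Set.powersetCard (Ovoid m) 2

end

end Suzuki

/-!
The Bruhat decomposition of `G₀`, which rests on one rational identity for `w t w` (`w_t_eq`), shows
that the stabilizer of `∞` and `0` in `G₀` consists of the `n_γ` alone. As `q - 1` is odd and `n_γ`
with `γ ≠ 1` fixes only `∞` and `0`, double transitivity gives `eq_one_of_fixes_two`: an element of
`G₀` that fixes two points and whose square fixes a third one is trivial.

Hence the stabilizer in `G₀` of two distinct pairs `ω₁`, `ω₂` acts faithfully on the two points of
`ω₁` and has order at most `2`, so that the stabilizer of `ω₁` and `ω₂` in `G` has order dividing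
`2 f`, `f = 2 m + 1` (`card_fixingSubgroup_dvd`). Each later element of an irredundant base costs
at least one prime factor of this order, which bounds the length by `2 + (1 + π(f))`. The stabilizer
of a single pair contains a conjugate of `w`, so the length is at least `2`.

Conversely, the stabilizer of `{∞, 0}` and `{∞, (1, y)}` consists of the field automorphisms fixing
`y`, and every subgroup of the cyclic group `Aut(F_q)` of order `f` occurs as the stabilizer of some
`y`. A chain of `k + 1` subgroups of `Aut(F_q)` descending to `1` thus yields an irredundant base of
length `k + 2`, for every `k ≤ π(f)`. One more step is gained by inserting the pair
`{(1, 0), (0, 1)}` after `{∞, 0}`: the common stabilizer of these two contains `⟨w⟩ × Aut(F_q)`, and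
`w` does not stabilize `{∞, (1, y)}`.
-/

open ArithmeticFunction

namespace Suzuki

variable {m : ℕ}

/-! ### Relations between the generators of the Suzuki group -/

theorem sigma_ne_zero {x : Fq m} (hx : x ≠ 0) : sigma m x ≠ 0 := by simpa using hx

@[simp] theorem t_none (a b : Fq m) : t a b none = none := rfl

@[simp] theorem t_some (a b : Fq m) (p : AffinePoint m) : t a b (some p) = some (tFun a b p) := rfl

@[simp] theorem n_none (γ : (Fq m)ˣ) : n γ none = none := rfl

@[simp] theorem n_some (γ : (Fq m)ˣ) (p : AffinePoint m) : n γ (some p) = some (nFun γ p) := rfl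

theorem w_apply (p : Ovoid m) : w m p = wFun p := rfl

@[simp] theorem w_none : w m none = some (origin m) := rfl

@[simp] theorem w_origin : w m (some (origin m)) = none := by
  rw [w_apply]
  simp [wFun, origin]

theorem w_some (p : AffinePoint m) (hz : p.z ≠ 0) : w m (some p) = some (wAffine p hz) := by
  rw [w_apply]
  simp [wFun, hz]

theorem w_mul_w : w m * w m = 1 := Equiv.ext (wFun_involutive m)

@[simp] theorem w_w (p : Ovoid m) : w m (w m p) = p := wFun_involutive m p

theorem t_mul_t (a b c d : Fq m) : t a b * t c d = t (a + c) (b + d + sigma m a * c) := by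
  ext1 p
  rcases p with _ | p
  · rfl
  · rw [Equiv.Perm.mul_apply, t_some, t_some, t_some]
    refine congrArg some (AffinePoint.ext' ?_ ?_) <;> simp only [tFun, map_add] <;> ring

theorem t_zero : t (0 : Fq m) 0 = 1 := by
  ext1 p
  rcases p with _ | p
  · rfl
  · refine congrArg some (AffinePoint.ext' ?_ ?_) <;> simp [tFun]

theorem t_inv (a b : Fq m) : (t a b)⁻¹ = t a (b + sigma m a * a) := by
  have h2 := two_eq_zero m
  rw [inv_eq_iff_mul_eq_one, t_mul_t, ← t_zero]
  congr 1
  · linear_combination a * h2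
  · linear_combination (b + sigma m a * a) * h2

theorem n_mul_n (γ δ : (Fq m)ˣ) : n γ * n δ = n (γ * δ) := by
  ext1 p
  rcases p with _ | p
  · rfl
  · rw [Equiv.Perm.mul_apply, n_some, n_some, n_some]
    refine congrArg some (AffinePoint.ext' ?_ ?_) <;>
      simp only [nFun, Units.val_mul, map_mul] <;> ring

theorem n_one : n (1 : (Fq m)ˣ) = 1 := by
  ext1 p
  rcases p with _ | p
  · rfl
  · refine congrArg some (AffinePoint.ext' ?_ ?_) <;> simp [nFun]

theorem n_mul_t (γ : (Fq m)ˣ) (a b : Fq m) :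
    n γ * t a b = t (γ * a : Fq m) (sigma m γ * γ * b) * n γ := by
  ext1 p
  rcases p with _ | p
  · rfl
  · rw [Equiv.Perm.mul_apply, Equiv.Perm.mul_apply, t_some, n_some, n_some, t_some]
    refine congrArg some (AffinePoint.ext' ?_ ?_) <;> simp only [nFun, tFun, map_mul] <;> ring

theorem t_mul_n (γ : (Fq m)ˣ) (a b : Fq m) : ∃ a' b', t a b * n γ = n γ * t a' b' := by
  refine ⟨(γ : Fq m)⁻¹ * a, (sigma m γ * γ : Fq m)⁻¹ * b, ?_⟩
  have hs : sigma m γ ≠ 0 := sigma_ne_zero γ.ne_zero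
  rw [n_mul_t, mul_inv_cancel_left₀ γ.ne_zero, mul_inv_cancel_left₀ (mul_ne_zero hs γ.ne_zero)]

theorem nFun_z_ne_zero {γ : (Fq m)ˣ} {p : AffinePoint m} (hz : p.z ≠ 0) : (nFun γ p).z ≠ 0 :=
  mul_ne_zero (mul_ne_zero (sigma_ne_zero γ.ne_zero) (pow_ne_zero _ γ.ne_zero)) hz

theorem nFun_origin (γ : (Fq m)ˣ) : nFun γ (origin m) = origin m :=
  AffinePoint.ext' (by simp [nFun, origin]) (by simp [nFun, origin])

theorem w_mul_n (γ : (Fq m)ˣ) : w m * n γ = n γ⁻¹ * w m := by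
  ext1 p
  rcases p with _ | p
  · exact congrArg some (nFun_origin _).symm
  · change w m (some (nFun γ p)) = n γ⁻¹ (w m (some p))
    by_cases hz : p.z = 0
    · rw [p.eq_origin hz, nFun_origin, w_origin, n_none]
    · have hs : sigma m γ ≠ 0 := sigma_ne_zero γ.ne_zero
      rw [w_some _ hz, w_some _ (nFun_z_ne_zero hz), n_some]
      refine congrArg some (AffinePoint.ext' ?_ ?_) <;>
        simp only [nFun, wAffine, Units.val_inv_eq_inv_val, map_inv₀] <;> field_simp

/-! ### The Bruhat decomposition -/

section FieldIdentities

variable {F : Type*} [Field F] [CharP F 2] {a b sa sb c z sz d sd sc x y Z Z' : F}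

/-! In the next lemmas `sa`, `sb`, … stand for `σ(a)`, `σ(b)`, …, and `z`, `Z`, `Z'` for the third
coordinates of the points `t_{a,b}(0)`, `(x, y, Z)` and `t_{a,b}(x, y, Z)`. -/

theorem bruhat_third_coord (hz : z ≠ 0) (hsz : sz ≠ 0) (hZ : Z ≠ 0)
    (ez : z = a * b + sa * a ^ 2 + sb) (esz : sz = sa * sb + a ^ 2 * sa ^ 2 + b ^ 2)
    (ec : c = (b + sa * a) / z) (ed : d = a / z) (esc : sc = (sb + a ^ 2 * sa) / sz)
    (esd : sd = sa / sz)
    (eq : Z' = Z + a * b + sa * a ^ 2 + sb + a * y + sa * a * x + b * x) :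
    1 / Z + c * (d + sc * c) + sc * c ^ 2 + (sd + c ^ 2 * sc) + c * (x / Z) + sc * c * (y / Z)
      + (d + sc * c) * (y / Z) = Z' / (Z * z) := by
  subst ec ed esc esd eq
  field_simp
  subst ez esz
  grind

theorem bruhat_first_coord (hz : z ≠ 0) (hsz : sz ≠ 0) (hZ : Z ≠ 0) (hZ' : Z' ≠ 0)
    (ez : z = a * b + sa * a ^ 2 + sb) (esz : sz = sa * sb + a ^ 2 * sa ^ 2 + b ^ 2)
    (ec : c = (b + sa * a) / z) (ed : d = a / z) (esc : sc = (sb + a ^ 2 * sa) / sz)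
    (eq : Z' = Z + a * b + sa * a ^ 2 + sb + a * y + sa * a * x + b * x) :
    (y + b + sa * x) / Z' =
      sz / z ^ 2 * ((x / Z + (d + sc * c) + sc * (y / Z)) / (Z' / (Z * z))) + b / z := by
  subst ec ed esc
  field_simp
  subst ez esz eq
  grind

theorem bruhat_second_coord (hz : z ≠ 0) (hsz : sz ≠ 0) (hZ : Z ≠ 0) (hZ' : Z' ≠ 0)
    (ez : z = a * b + sa * a ^ 2 + sb) (esz : sz = sa * sb + a ^ 2 * sa ^ 2 + b ^ 2)
    (ec : c = (b + sa * a) / z) (ed : d = a / z) (esc : sc = (sb + a ^ 2 * sa) / sz)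
    (eq : Z' = Z + a * b + sa * a ^ 2 + sb + a * y + sa * a * x + b * x) :
    (x + a) / Z' =
      z ^ 2 / sz ^ 2 * (sz / z ^ 2) * ((y / Z + c) / (Z' / (Z * z))) + a / z
        + sb / sz * (sz / z ^ 2 * ((x / Z + (d + sc * c) + sc * (y / Z)) / (Z' / (Z * z)))) := by
  subst ec ed esc
  field_simp
  subst ez esz eq
  grind

theorem bruhat_third_coord_origin (hz : z ≠ 0) (hsz : sz ≠ 0)
    (ez : z = a * b + sa * a ^ 2 + sb) (esz : sz = sa * sb + a ^ 2 * sa ^ 2 + b ^ 2)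
    (ec : c = (b + sa * a) / z) (ed : d = a / z) (esc : sc = (sb + a ^ 2 * sa) / sz)
    (esd : sd = sa / sz) :
    c * (d + sc * c) + sc * c ^ 2 + (sd + c ^ 2 * sc) = 1 / z := by
  subst ec ed esc esd
  field_simp
  subst ez esz
  grind

theorem bruhat_first_coord_origin (hz : z ≠ 0) (hsz : sz ≠ 0)
    (ez : z = a * b + sa * a ^ 2 + sb) (esz : sz = sa * sb + a ^ 2 * sa ^ 2 + b ^ 2)
    (ec : c = (b + sa * a) / z) (ed : d = a / z) (esc : sc = (sb + a ^ 2 * sa) / sz) :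
    0 = sz / z ^ 2 * ((d + sc * c) / (1 / z)) + b / z := by
  subst ec ed esc
  field_simp
  subst ez esz
  grind

theorem bruhat_second_coord_origin (hz : z ≠ 0) (hsz : sz ≠ 0)
    (ez : z = a * b + sa * a ^ 2 + sb) (esz : sz = sa * sb + a ^ 2 * sa ^ 2 + b ^ 2)
    (ec : c = (b + sa * a) / z) (ed : d = a / z) (esc : sc = (sb + a ^ 2 * sa) / sz) :
    0 = z ^ 2 / sz ^ 2 * (sz / z ^ 2) * (c / (1 / z)) + a / z
        + sb / sz * (sz / z ^ 2 * ((d + sc * c) / (1 / z))) := by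
  subst ec ed esc
  field_simp
  subst ez esz
  grind

end FieldIdentities

/-- The relation `w t_{a,b} w = t n_γ w t'`, with both sides applied to `w p`. Its parameters are
forced: `t` maps `0` to `w (t_{a,b} 0)`, the inverse of `t'` maps `0` to `w (t_{a,b}⁻¹ 0)`, which
has first two coordinates `c` and `d`, and `γ = z ^ (σ - 2)` up to a constant by
homogeneity: conjugating `t_{a,b}` by `n_δ` multiplies `z` by `δ ^ (σ + 2)` and, as
`w n_δ = n_δ⁻¹ w`, multiplies `γ` by `δ ^ (-2)`. -/
theorem w_t_eq {a b z c d : Fq m} (hz : z ≠ 0) (ez : z = a * b + sigma m a * a ^ 2 + sigma m b)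
    (ec : c = (b + sigma m a * a) / z) (ed : d = a / z) {γ : (Fq m)ˣ}
    (hγ : (γ : Fq m) = sigma m z / z ^ 2) (p : Ovoid m) :
    w m (t a b p) =
      t (b / z) (a / z) (n γ (w m (t c (d + sigma m c * c) (w m p)))) := by
  have hsz : sigma m z ≠ 0 := sigma_ne_zero hz
  have h2 := two_eq_zero m
  have esz : sigma m z = sigma m a * sigma m b + a ^ 2 * sigma m a ^ 2 + b ^ 2 := by
    rw [ez]
    simp only [map_add, map_mul, map_pow, sigma_sigma]
  have hsγ : sigma m γ = z ^ 2 / sigma m z ^ 2 := by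
    rw [hγ]
    simp only [map_div₀, map_pow, sigma_sigma]
  have esc : sigma m c = (sigma m b + a ^ 2 * sigma m a) / sigma m z := by
    rw [ec]
    simp only [map_div₀, map_add, map_mul, sigma_sigma]
  have esd : sigma m d = sigma m a / sigma m z := by rw [ed, map_div₀]
  rcases p with _ | p
  · have e3 : (tFun c (d + sigma m c * c) (origin m)).z = 1 / z := by
      have := bruhat_third_coord_origin hz hsz ez esz ec ed esc esd
      simp only [tFun, origin, map_add, map_mul, sigma_sigma]
      linear_combination this
    have h0 : (tFun c (d + sigma m c * c) (origin m)).z ≠ 0 := by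
      rw [e3]
      exact one_div_ne_zero hz
    rw [w_none, t_none, w_none, t_some, w_some _ h0, n_some, t_some]
    refine congrArg some (AffinePoint.ext' ?_ ?_)
    · have := bruhat_first_coord_origin hz hsz ez esz ec ed esc
      simp only [nFun, tFun, wAffine, origin] at e3 ⊢
      rw [e3, hγ]
      linear_combination this
    · have := bruhat_second_coord_origin hz hsz ez esz ec ed esc
      simp only [nFun, tFun, wAffine, origin] at e3 ⊢
      rw [e3, hsγ, hγ, map_div₀]
      linear_combination this
  · by_cases hZ : p.z = 0
    · have e3 : (tFun a b (origin m)).z = z := by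
        simp only [tFun, origin]
        linear_combination -ez
      rw [p.eq_origin hZ, w_origin, t_none, w_none, t_some, w_some _ (e3.trans_ne hz), n_some,
        t_some, nFun_origin]
      refine congrArg some (AffinePoint.ext' ?_ ?_)
      · simp only [wAffine, e3]
        simp [tFun, origin]
      · simp only [wAffine, e3]
        simp [tFun, origin]
    rw [w_some p hZ, t_some, t_some]
    have e3 : (tFun c (d + sigma m c * c) (wAffine p hZ)).z = (tFun a b p).z / (p.z * z) := by
      have := bruhat_third_coord (x := p.x) (y := p.y) hz hsz hZ ez esz ec ed esc esd rfl
      simp only [tFun, wAffine, map_add, map_mul, sigma_sigma]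
      exact this
    by_cases hZ' : (tFun a b p).z = 0
    · have h0 : (tFun c (d + sigma m c * c) (wAffine p hZ)).z = 0 := by rw [e3, hZ', zero_div]
      rw [AffinePoint.eq_origin hZ', AffinePoint.eq_origin h0, w_origin, n_none, t_none]
    · have h0 : (tFun c (d + sigma m c * c) (wAffine p hZ)).z ≠ 0 := by
        rw [e3]
        exact div_ne_zero hZ' (mul_ne_zero hZ hz)
      rw [w_some _ hZ', w_some _ h0, n_some, t_some]
      refine congrArg some (AffinePoint.ext' ?_ ?_)
      · have := bruhat_first_coord (x := p.x) (y := p.y) hz hsz hZ hZ' ez esz ec ed esc rfl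
        rw [← e3, ← hγ] at this
        exact this
      · have := bruhat_second_coord (x := p.x) (y := p.y) hz hsz hZ hZ' ez esz ec ed esc rfl
        rw [← e3, ← hγ, ← hsγ, ← map_div₀] at this
        exact this

theorem eq_zero_of_third_coord_eq_zero {a b : Fq m}
    (h : a * b + sigma m a * a ^ 2 + sigma m b = 0) : a = 0 ∧ b = 0 := by
  have := AffinePoint.eq_origin (p := ⟨a, b, 0, h.symm⟩) rfl
  exact ⟨congrArg AffinePoint.x this, congrArg AffinePoint.y this⟩

theorem w_mul_t_mul_w {a b : Fq m} (h : ¬ (a = 0 ∧ b = 0)) :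
    ∃ γ a' b' c d, w m * t a b * w m = n γ * t a' b' * w m * t c d := by
  obtain ⟨z, hz⟩ : ∃ z, z = a * b + sigma m a * a ^ 2 + sigma m b := ⟨_, rfl⟩
  have hz0 : z ≠ 0 := fun h0 => h (eq_zero_of_third_coord_eq_zero (hz ▸ h0))
  let γ : (Fq m)ˣ :=
    Units.mk0 (sigma m z / z ^ 2) (div_ne_zero (sigma_ne_zero hz0) (pow_ne_zero _ hz0))
  obtain ⟨a', b', ht⟩ := t_mul_n γ (b / z) (a / z)
  refine ⟨γ, a', b', (b + sigma m a * a) / z,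
    a / z + sigma m ((b + sigma m a * a) / z) * ((b + sigma m a * a) / z), ?_⟩
  rw [← ht]
  ext1 p
  simpa using w_t_eq hz0 hz rfl rfl (γ := γ) rfl (w m p)

/-- The permutations of the form `n_γ t_{a,b}` or `n_γ t_{a,b} w t_{c,d}`, that is, those in the
union of the two Bruhat cells. -/
def IsBruhat (g : Equiv.Perm (Ovoid m)) : Prop :=
  (∃ γ a b, g = n γ * t a b) ∨ ∃ γ a b c d, g = n γ * t a b * w m * t c d

theorem IsBruhat.n_mul {g : Equiv.Perm (Ovoid m)} (hg : IsBruhat g) (δ : (Fq m)ˣ) :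
    IsBruhat (n δ * g) := by
  rcases hg with ⟨γ, a, b, rfl⟩ | ⟨γ, a, b, c, d, rfl⟩
  · exact .inl ⟨δ * γ, a, b, by rw [← n_mul_n, mul_assoc]⟩
  · exact .inr ⟨δ * γ, a, b, c, d, by simp only [← n_mul_n, mul_assoc]⟩

theorem IsBruhat.mul_t {g : Equiv.Perm (Ovoid m)} (hg : IsBruhat g) (a' b' : Fq m) :
    IsBruhat (g * t a' b') := by
  rcases hg with ⟨γ, a, b, rfl⟩ | ⟨γ, a, b, c, d, rfl⟩
  · exact .inl ⟨γ, _, _, by rw [mul_assoc, t_mul_t]⟩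
  · exact .inr ⟨γ, a, b, _, _, by rw [mul_assoc _ (t c d), t_mul_t]⟩

theorem IsBruhat.t_mul {g : Equiv.Perm (Ovoid m)} (hg : IsBruhat g) (a' b' : Fq m) :
    IsBruhat (t a' b' * g) := by
  rcases hg with ⟨γ, a, b, rfl⟩ | ⟨γ, a, b, c, d, rfl⟩
  all_goals obtain ⟨a'', b'', h⟩ := t_mul_n γ a' b'
  · exact .inl ⟨γ, _, _, by rw [← mul_assoc, h, mul_assoc, t_mul_t]⟩
  · exact .inr ⟨γ, _, _, c, d, by
      rw [← mul_assoc, ← mul_assoc, ← mul_assoc, h, mul_assoc (n γ), t_mul_t]⟩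

theorem IsBruhat.w_mul {g : Equiv.Perm (Ovoid m)} (hg : IsBruhat g) : IsBruhat (w m * g) := by
  rcases hg with ⟨γ, a, b, rfl⟩ | ⟨γ, a, b, c, d, rfl⟩
  · exact .inr ⟨γ⁻¹, 0, 0, a, b, by rw [← mul_assoc, w_mul_n, t_zero, mul_one]⟩
  · have e : w m * (n γ * t a b * w m * t c d) = n γ⁻¹ * (w m * t a b * w m * t c d) := by
      simp only [← mul_assoc, w_mul_n]
    rw [e]
    refine IsBruhat.n_mul (IsBruhat.mul_t ?_ c d) _
    by_cases h : a = 0 ∧ b = 0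
    · rw [h.1, h.2, t_zero, mul_one, w_mul_w]
      exact .inl ⟨1, 0, 0, by rw [n_one, t_zero, mul_one]⟩
    · exact .inr (w_mul_t_mul_w h)

theorem t_mem (a b : Fq m) : t a b ∈ suzukiGroup m :=
  Subgroup.subset_closure (.inl (.inr ⟨(a, b), rfl⟩))

theorem n_mem (γ : (Fq m)ˣ) : n γ ∈ suzukiGroup m := Subgroup.subset_closure (.inr ⟨γ, rfl⟩)

theorem w_mem : w m ∈ suzukiGroup m := Subgroup.subset_closure (.inl (.inl rfl))

/-- The Bruhat decomposition of the Suzuki group. -/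
theorem isBruhat_of_mem {g : Equiv.Perm (Ovoid m)} (hg : g ∈ suzukiGroup m) : IsBruhat g := by
  induction hg using Subgroup.closure_induction_left with
  | one => exact .inl ⟨1, 0, 0, by rw [n_one, t_zero, mul_one]⟩
  | mul_left x hx y _ hy =>
    rcases hx with (rfl | ⟨⟨a, b⟩, rfl⟩) | ⟨γ, rfl⟩
    · exact hy.w_mul
    · exact hy.t_mul a b
    · exact hy.n_mul γ
  | inv_mul_cancel x hx y _ hy =>
    rcases hx with (rfl | ⟨⟨a, b⟩, rfl⟩) | ⟨γ, rfl⟩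
    · rw [inv_eq_of_mul_eq_one_left w_mul_w]
      exact hy.w_mul
    · rw [t_inv]
      exact hy.t_mul _ _
    · have h : n γ⁻¹ * n γ = 1 := by rw [n_mul_n, inv_mul_cancel, n_one]
      rw [inv_eq_of_mul_eq_one_left h]
      exact hy.n_mul _

/-! ### Point stabilizers -/

theorem tFun_origin_eq (a b : Fq m) :
    (tFun a b (origin m)).x = a ∧ (tFun a b (origin m)).y = b := by
  simp [tFun, origin]

/-- The stabilizer of `∞` and `0` in `G₀` is the torus of all `n_γ`. -/
theorem eq_n_of_fixes {g : Equiv.Perm (Ovoid m)} (hg : g ∈ suzukiGroup m)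
    (h1 : g none = none) (h2 : g (some (origin m)) = some (origin m)) : ∃ γ, g = n γ := by
  rcases isBruhat_of_mem hg with ⟨γ, a, b, rfl⟩ | ⟨γ, a, b, c, d, rfl⟩
  · rw [Equiv.Perm.mul_apply, ← Equiv.eq_symm_apply, t_some] at h2
    have h3 : (n γ).symm (some (origin m)) = some (origin m) := by
      rw [Equiv.symm_apply_eq, n_some, nFun_origin]
    rw [h3] at h2
    have h4 := Option.some.inj h2
    obtain ⟨hx, hy⟩ := tFun_origin_eq a b
    rw [h4] at hx hy
    refine ⟨γ, ?_⟩
    rw [← hx, ← hy]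
    change n γ * t 0 0 = _
    rw [t_zero, mul_one]
  · simp at h1

/-- The group `G₀` acts doubly transitively on the ovoid. -/
theorem exists_map_none_origin {p q : Ovoid m} (hpq : p ≠ q) :
    ∃ g ∈ suzukiGroup m, g p = none ∧ g q = some (origin m) := by
  have key : ∀ p : AffinePoint m, ∃ g ∈ suzukiGroup m,
      g none = none ∧ g (some p) = some (origin m) := by
    intro p
    refine ⟨(t p.x p.y)⁻¹, inv_mem (t_mem _ _), ?_, ?_⟩
    · rw [Equiv.Perm.inv_eq_iff_eq, t_none]
    · rw [Equiv.Perm.inv_eq_iff_eq, t_some]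
      exact congrArg some (AffinePoint.ext' (tFun_origin_eq _ _).1.symm (tFun_origin_eq _ _).2.symm)
  have key2 : ∃ g ∈ suzukiGroup m, g p = none := by
    rcases p with _ | p
    · exact ⟨1, one_mem _, rfl⟩
    · obtain ⟨g, hg, -, h⟩ := key p
      exact ⟨w m * g, mul_mem w_mem hg, by rw [Equiv.Perm.mul_apply, h, w_origin]⟩
  obtain ⟨g, hg, hp⟩ := key2
  obtain ⟨q', hq⟩ : ∃ q', g q = some q' := by
    rw [← Option.ne_none_iff_exists']
    exact fun h => hpq (g.injective (hp.trans h.symm))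
  obtain ⟨h, hh, h1, h2⟩ := key q'
  exact ⟨h * g, mul_mem hh hg, by rw [Equiv.Perm.mul_apply, hp, h1],
    by rw [Equiv.Perm.mul_apply, hq, h2]⟩

theorem eq_one_of_nFun_eq {γ : (Fq m)ˣ} {p : AffinePoint m} (hp : p ≠ origin m)
    (h : nFun γ p = p) : γ = 1 := by
  have hx : (γ : Fq m) * p.x = p.x := congrArg AffinePoint.x h
  have hy : sigma m γ * γ * p.y = p.y := congrArg AffinePoint.y h
  ext
  by_cases hx0 : p.x = 0
  · -- `γ ^ (σ + 1) = 1`; dividing the image under `σ`, `γ ^ (2 + σ) = 1`, by it leaves `γ = 1`.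
    have hy0 : p.y ≠ 0 := fun h0 => hp (AffinePoint.ext' hx0 h0)
    have h1 : sigma m γ * γ = 1 := mul_right_cancel₀ hy0 (hy.trans (one_mul _).symm)
    have h2 := congrArg (sigma m) h1
    rw [map_mul, sigma_sigma, map_one] at h2
    rw [Units.val_one]
    linear_combination h2 - γ * h1
  · exact mul_right_cancel₀ hx0 (by simpa using hx)

/-- The stabilizer of two points in `G₀` acts freely on the remaining points and has no involutions,
so that already a fixed point of `g ^ 2` outside the two forces `g = 1`. -/
theorem eq_one_of_fixes_two {g : Equiv.Perm (Ovoid m)} (hg : g ∈ suzukiGroup m) {p q r : Ovoid m}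
    (hpq : p ≠ q) (hrp : r ≠ p) (hrq : r ≠ q) (hp : g p = p) (hq : g q = q) (hr : g (g r) = r) :
    g = 1 := by
  obtain ⟨h, hh, h1, h2⟩ := exists_map_none_origin hpq
  obtain ⟨γ, hγ⟩ := eq_n_of_fixes (g := h * g * h⁻¹) (mul_mem (mul_mem hh hg) (inv_mem hh))
    (by simp [← h1, hp]) (by simp [← h2, hq])
  have hr' : n γ (n γ (h r)) = h r := by simp [← hγ, hr]
  obtain ⟨r', hr2⟩ : ∃ r', h r = some r' := by
    rw [← Option.ne_none_iff_exists']
    exact fun h0 => hrp (h.injective (h0.trans h1.symm))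
  have hr0 : r' ≠ origin m := by
    rintro rfl
    exact hrq (h.injective (hr2.trans h2.symm))
  rw [← Equiv.Perm.mul_apply, n_mul_n, hr2, n_some] at hr'
  have h3 := eq_one_of_nFun_eq hr0 (Option.some.inj hr')
  have h4 : γ = 1 := by
    ext
    have h5 : (γ : Fq m) * γ = 1 := by rw [← Units.val_mul, h3, Units.val_one]
    have h6 : ((γ : Fq m) - 1) ^ 2 = 0 := by
      linear_combination h5 + (1 - γ) * two_eq_zero m
    exact sub_eq_zero.mp (pow_eq_zero_iff two_ne_zero |>.mp h6)
  rw [h4, n_one] at hγ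
  exact conj_eq_one_iff.mp hγ

end Suzuki

/-! ### Irredundant bases and chains of subgroups -/

/-- Strictness of the chain of stabilizers is witnessed by elements that fix all the earlier members
of the base and move the next one. -/
theorem isIrredundantBase_iff {G Ω : Type*} [Group G] [MulAction G Ω] {ℓ : ℕ} {ω : Fin ℓ → Ω} :
    IsIrredundantBase G ω ↔
      (∀ i, ∃ g : G, (∀ j < i, g • ω j = ω j) ∧ g • ω i ≠ ω i) ∧
        ∀ g : G, (∀ i, g • ω i = ω i) → g = 1 := by
  have key : ∀ i, fixingSubgroup G (ω '' Set.Iic i) < fixingSubgroup G (ω '' Set.Iio i) ↔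
      ∃ g : G, (∀ j < i, g • ω j = ω j) ∧ g • ω i ≠ ω i := by
    intro i
    have hle : fixingSubgroup G (ω '' Set.Iic i) ≤ fixingSubgroup G (ω '' Set.Iio i) :=
      fixingSubgroup_antitone G Ω (Set.image_mono Set.Iio_subset_Iic_self)
    rw [lt_iff_le_not_ge, and_iff_right hle, SetLike.not_le_iff_exists]
    refine exists_congr fun g => ?_
    simp only [mem_fixingSubgroup_iff, Set.forall_mem_image, Set.mem_Iio, Set.mem_Iic]
    refine and_congr_right fun h => not_congr ⟨fun h' => h' le_rfl, fun h' j hj => ?_⟩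
    rcases hj.lt_or_eq with hj | rfl
    exacts [h hj, h']
  refine ⟨fun h => ⟨fun i => (key i).mp (h.strict i), fun g hg => ?_⟩,
    fun h => ⟨fun i => (key i).mpr (h.1 i), ?_⟩⟩
  · rw [← Subgroup.mem_bot, ← h.trivial, mem_fixingSubgroup_iff]
    rintro _ ⟨i, rfl⟩
    exact hg i
  · rw [Subgroup.eq_bot_iff_forall]
    intro g hg
    exact h.2 g fun i => (mem_fixingSubgroup_iff G).mp hg _ ⟨i, rfl⟩

theorem cardFactors_card_lt {G : Type*} [Group G] [Finite G] {H K : Subgroup G} (h : H < K) :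
    cardFactors (Nat.card H) < cardFactors (Nat.card K) := by
  have h0 : H.relIndex K ≠ 0 := Subgroup.index_ne_zero_of_finite
  have h1 : H.relIndex K ≠ 1 := fun h1 => h.not_ge (Subgroup.relIndex_eq_one.mp h1)
  have h2 : Nat.card K = Nat.card H * H.relIndex K := by
    rw [← Subgroup.card_mul_index (H.subgroupOf K),
      Nat.card_congr (Subgroup.subgroupOfEquivOfLe h.le).toEquiv, Subgroup.relIndex]
  rw [h2, cardFactors_mul Nat.card_pos.ne' h0, lt_add_iff_pos_right, cardFactors_pos_iff_one_lt]
  omega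

/-- Each step of the chain of stabilizers removes at least one prime factor of the order, so the
order of the stabilizer of the first `r` members bounds the length of the rest of the base. -/
theorem IsIrredundantBase.le_cardFactors {G Ω : Type*} [Group G] [Finite G] [MulAction G Ω]
    {ℓ : ℕ} {ω : Fin ℓ → Ω} (h : IsIrredundantBase G ω) {r : ℕ} (hr : r ≤ ℓ) :
    ℓ ≤ r + cardFactors (Nat.card (fixingSubgroup G (ω '' {j | j.val < r}))) := by
  suffices H : ∀ i, r + i ≤ ℓ →
      i + cardFactors (Nat.card (fixingSubgroup G (ω '' {j | j.val < r + i}))) ≤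
        cardFactors (Nat.card (fixingSubgroup G (ω '' {j | j.val < r}))) by
    have := H (ℓ - r) (by omega)
    omega
  intro i
  induction i with
  | zero => intro _; simp
  | succ i ih =>
    intro hi
    have h1 := ih (by omega)
    have h2 := cardFactors_card_lt (h.strict ⟨r + i, by omega⟩)
    have e1 : Set.Iic (⟨r + i, by omega⟩ : Fin ℓ) = {j | j.val < r + (i + 1)} := by
      ext j
      simp only [Set.mem_Iic, Fin.le_def, Set.mem_ofPred_eq]
      omega
    have e2 : Set.Iio (⟨r + i, by omega⟩ : Fin ℓ) = {j | j.val < r + i} := by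
      ext j
      simp only [Set.mem_Iio, Fin.lt_def, Set.mem_ofPred_eq]
    rw [e1, e2] at h2
    omega

/-- A cyclic group of order `N` has a chain of subgroups `1 = H₀ < H₁ < ⋯` of length `Ω(N)`. -/
theorem exists_chain_subgroup (C : Type*) [Group C] [Finite C] [IsCyclic C] :
    ∃ H : ℕ → Subgroup C, Monotone H ∧ H 0 = ⊥ ∧
      ∀ j < cardFactors (Nat.card C), H j < H (j + 1) := by
  obtain ⟨g, hg⟩ := IsCyclic.exists_ofOrder_eq_natCard (α := C)
  have hN : Nat.card C ≠ 0 := Nat.card_pos.ne'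
  -- `H j` has order `D j`, the product of the first `j` prime factors of the order of `C`.
  let D : ℕ → ℕ := fun j => ((Nat.card C).primeFactorsList.take j).prod
  have hDN : ∀ j, D j ∣ Nat.card C := fun j => by
    conv_rhs => rw [← Nat.prod_primeFactorsList hN]
    exact (List.take_sublist _ _).prod_dvd_prod
  have hDmono : ∀ i j, i ≤ j → D i ∣ D j := fun i j hij =>
    ((List.take_prefix_take_left hij).sublist).prod_dvd_prod
  let H : ℕ → Subgroup C := fun j => Subgroup.zpowers (g ^ (Nat.card C / D j))
  have hcard : ∀ j, Nat.card (H j) = D j := fun j => by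
    rw [Nat.card_zpowers, orderOf_pow_of_dvd, hg, Nat.div_div_self (hDN j) hN]
    · exact (Nat.div_pos (Nat.le_of_dvd (Nat.pos_of_ne_zero hN) (hDN j))
        (Nat.pos_of_dvd_of_pos (hDN j) (Nat.pos_of_ne_zero hN))).ne'
    · rw [hg]
      exact Nat.div_dvd_of_dvd (hDN j)
  have hmono : Monotone H := fun i j hij => by
    rw [Subgroup.zpowers_le]
    obtain ⟨c, hc⟩ := Nat.div_dvd_div_left (hDN j) (hDmono i j hij)
    rw [hc, pow_mul]
    exact Subgroup.npow_mem_zpowers _ _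
  refine ⟨H, hmono, ?_, fun j hj => ?_⟩
  · rw [← Subgroup.card_eq_one, hcard]
    simp [D]
  · refine lt_of_le_of_ne (hmono j.le_succ) fun he => ?_
    have h1 : D j = D (j + 1) := by rw [← hcard, he, hcard]
    rw [cardFactors_apply] at hj
    have h2 : D (j + 1) = D j * (Nat.card C).primeFactorsList[j] := List.prod_take_succ _ _ hj
    have h3 := (Nat.prime_of_mem_primeFactorsList (List.getElem_mem hj)).one_lt
    have h4 := Nat.pos_of_dvd_of_pos (hDN j) (Nat.pos_of_ne_zero hN)
    nlinarith

/-! ### Automorphisms of finite fields -/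

/-- In a finite field, every group of automorphisms is the stabilizer of a single element: a
generator of the multiplicative group of its fixed field. -/
theorem exists_forall_mem_iff_apply_eq {K : Type*} [Field K] [Finite K] (H : Subgroup (RingAut K)) :
    ∃ y : K, ∀ φ : RingAut K, φ ∈ H ↔ φ y = y := by
  have : Finite (RingAut K) := Finite.of_injective (fun φ => (φ : K → K)) DFunLike.coe_injective
  obtain ⟨u, hu⟩ := IsCyclic.exists_generator (α := (FixedPoints.subfield H K)ˣ)
  refine ⟨((u : FixedPoints.subfield H K) : K), fun φ =>
    ⟨fun hφ => (u : FixedPoints.subfield H K).2 ⟨φ, hφ⟩, fun hφ => ?_⟩⟩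
  have hfix : ∀ x : FixedPoints.subfield H K, φ x = x := by
    intro x
    by_cases hx : x = 0
    · rw [hx]
      simp
    · obtain ⟨i, hi⟩ := hu (Units.mk0 x hx)
      have hi' : (x : K) = (((u : FixedPoints.subfield H K) : K)) ^ i := by
        have := congrArg (fun v : (FixedPoints.subfield H K)ˣ =>
          (FixedPoints.subfield H K).subtype v) hi
        simpa only [Units.val_zpow_eq_zpow_val, map_zpow₀, Units.val_mk0, Subfield.subtype_apply]
          using this.symm
      rw [hi', map_zpow₀, hφ]
  obtain ⟨h, hh⟩ := FixedPoints.toAlgAut_surjective H K (AlgEquiv.ofRingEquiv (f := φ) hfix)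
  have : (h : RingAut K) = φ := by
    ext x
    exact congrArg (fun e : K ≃ₐ[FixedPoints.subfield H K] K => e x) hh
  exact this ▸ h.2

/-- Ring automorphisms of a `ZMod p`-algebra are automatically linear over `ZMod p`. -/
def algAutEquivRingAut (p : ℕ) (K : Type*) [CommRing K] [Algebra (ZMod p) K] :
    (K ≃ₐ[ZMod p] K) ≃* RingAut K where
  toFun e := e.toRingEquiv
  invFun φ := AlgEquiv.ofRingEquiv (f := φ) fun x => by
    have h : (φ : K →+* K).comp (algebraMap (ZMod p) K) = algebraMap (ZMod p) K :=
      Subsingleton.elim _ _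
    exact RingHom.congr_fun h x
  left_inv _ := rfl
  right_inv _ := rfl
  map_mul' _ _ := rfl

namespace Suzuki

variable {m : ℕ}

theorem card_ringAut : Nat.card (RingAut (Fq m)) = 2 * m + 1 := by
  rw [← Nat.card_congr (algAutEquivRingAut 2 (Fq m)).toEquiv, IsGalois.card_aut_eq_finrank,
    GaloisField.finrank 2 (by omega)]

instance : IsCyclic (RingAut (Fq m)) :=
  isCyclic_of_surjective _ (algAutEquivRingAut 2 (Fq m)).surjective

/-- There are `y₀, …, y_k` in `F_q`, for every `k ≤ Ω(f)`, whose stabilizers in `Aut(F_q)` form a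
strictly descending chain that ends in `1`. -/
theorem exists_chain_field {k : ℕ} (hk : k ≤ cardFactors (2 * m + 1)) :
    ∃ y : Fin (k + 1) → Fq m,
      (∀ i : Fin k, ∃ φ : RingAut (Fq m),
        (∀ j ≤ i.castSucc, φ (y j) = y j) ∧ φ (y i.succ) ≠ y i.succ) ∧
      ∀ φ : RingAut (Fq m), φ (y (Fin.last k)) = y (Fin.last k) → φ = 1 := by
  have : Finite (RingAut (Fq m)) :=
    Finite.of_injective (fun φ => (φ : Fq m → Fq m)) DFunLike.coe_injective
  obtain ⟨H, hmono, h0, hlt⟩ := exists_chain_subgroup (RingAut (Fq m))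
  rw [card_ringAut] at hlt
  choose y hy using fun H : Subgroup (RingAut (Fq m)) => exists_forall_mem_iff_apply_eq H
  refine ⟨fun i => y (H (k - i)), fun i => ?_, fun φ hφ => ?_⟩
  · obtain ⟨φ, h1, h2⟩ := SetLike.exists_of_lt (hlt (k - (i + 1)) (by omega))
    refine ⟨φ, fun j hj => (hy _ φ).mp (hmono ?_ h1), fun h => h2 ((hy _ φ).mpr h)⟩
    have : (j : ℕ) ≤ i := hj
    omega
  · have := (hy _ φ).mpr hφ
    rwa [Fin.val_last, Nat.sub_self, h0, Subgroup.mem_bot] at this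

open scoped Pointwise

/-! ### Pairs of points -/

/-- The `2`-subset `{p, q}` of the ovoid. -/
noncomputable def pair (p q : Ovoid m) (h : p ≠ q) : OvoidPairs m := ⟨{p, q}, Finset.card_pair h⟩

theorem exists_eq_pair (s : OvoidPairs m) : ∃ p q h, s = pair p q h := by
  obtain ⟨p, q, h, hs⟩ := Finset.card_eq_two.mp s.2
  exact ⟨p, q, h, Subtype.ext hs⟩

theorem smul_pair_eq_pair_iff {g : SuzukiAut m} {p q p' q' : Ovoid m} {h : p ≠ q} {h' : p' ≠ q'} :
    g • pair p q h = pair p' q' h' ↔ g • p = p' ∧ g • q = q' ∨ g • p = q' ∧ g • q = p' := by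
  rw [Subtype.ext_iff, Set.powersetCard.coe_smul]
  change g • ({p, q} : Finset (Ovoid m)) = {p', q'} ↔ _
  rw [Finset.smul_finset_insert, Finset.smul_finset_singleton, ← Finset.coe_inj]
  push_cast
  exact Set.pair_eq_pair_iff

theorem inl_smul (g : suzukiGroup m) (p : Ovoid m) :
    (SemidirectProduct.inl g : SuzukiAut m) • p = (g : Equiv.Perm (Ovoid m)) p := by
  rw [smul_def, SemidirectProduct.left_inl, SemidirectProduct.right_inl, map_one]
  rfl

theorem inr_smul (φ : RingAut (Fq m)) (p : Ovoid m) :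
    (SemidirectProduct.inr φ : SuzukiAut m) • p = fieldPerm m φ p := by
  rw [smul_def, SemidirectProduct.left_inr, SemidirectProduct.right_inr]
  rfl

theorem smul_eq_left {g : SuzukiAut m} (hg : g.right = 1) (p : Ovoid m) :
    g • p = (g.left : Equiv.Perm (Ovoid m)) p := by
  rw [smul_def, hg, map_one]
  rfl

instance : Finite (AffinePoint m) :=
  Finite.of_injective (fun p => (p.x, p.y)) fun _ _ h =>
    AffinePoint.ext' (congrArg Prod.fst h) (congrArg Prod.snd h)

instance : Finite (RingAut (Fq m)) :=
  Finite.of_injective (fun φ => (φ : Fq m → Fq m)) DFunLike.coe_injective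

instance : Finite (SuzukiAut m) := Finite.of_equiv _ SemidirectProduct.equivProd.symm

/-! ### Stabilizers of pairs -/

theorem smul_smul_eq_of_smul_pair_eq {g : SuzukiAut m} {p q : Ovoid m} {h : p ≠ q}
    (hg : g • pair p q h = pair p q h) : g • g • p = p := by
  rcases smul_pair_eq_pair_iff.mp hg with ⟨h1, h2⟩ | ⟨h1, h2⟩
  · rw [h1, h1]
  · rw [h1, h2]

/-- An element of `G₀` that fixes both points of a pair and stabilizes another pair is trivial: the
other pair has a point outside the first, and the square of the element fixes it. -/
theorem eq_one_of_fixes_of_smul_eq {g : SuzukiAut m} (hr : g.right = 1) {p q : Ovoid m} {h : p ≠ q}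
    {s : OvoidPairs m} (hs : pair p q h ≠ s) (hp : g • p = p) (hq : g • q = q) (hg : g • s = s) :
    g = 1 := by
  obtain ⟨r, r', h', rfl⟩ := exists_eq_pair s
  have hg' : g • pair r' r h'.symm = pair r' r h'.symm := by
    rw [smul_pair_eq_pair_iff] at hg ⊢
    tauto
  have key : ∀ x, g • g • x = x → x ≠ p → x ≠ q → g = 1 := by
    intro x hx hxp hxq
    rw [smul_eq_left hr, smul_eq_left hr] at hx
    rw [smul_eq_left hr] at hp hq
    refine SemidirectProduct.ext (Subtype.ext ?_) hr
    exact eq_one_of_fixes_two g.left.2 h hxp hxq hp hq hx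
  by_contra hne
  have h1 := fun h1 h2 => hne (key r (smul_smul_eq_of_smul_pair_eq hg) h1 h2)
  have h2 := fun h1 h2 => hne (key r' (smul_smul_eq_of_smul_pair_eq hg') h1 h2)
  refine hs ((one_smul (SuzukiAut m) _).symm.trans (smul_pair_eq_pair_iff.mpr ?_))
  rw [one_smul, one_smul]
  by_cases e1 : r = p
  · refine .inl ⟨e1.symm, ?_⟩
    by_contra e2
    exact h2 (fun e3 => h' (e1.trans e3.symm)) (fun e3 => e2 e3.symm)
  · have e2 : r = q := by
      by_contra e2
      exact h1 e1 e2
    refine .inr ⟨?_, e2.symm⟩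
    by_contra e3
    exact h2 (fun e4 => e3 e4.symm) (fun e4 => h' (e2.trans e4.symm))

/-- The stabilizer in `G` of two distinct pairs meets `G₀` in a group of order at most `2` and has
its image in `Aut(F_q)`, a group of order `2 m + 1`. -/
theorem card_fixingSubgroup_dvd {s s' : OvoidPairs m} (hs : s ≠ s') {S : Set (OvoidPairs m)}
    (h1 : s ∈ S) (h2 : s' ∈ S) :
    Nat.card (fixingSubgroup (SuzukiAut m) S) ∣ 2 * (2 * m + 1) := by
  obtain ⟨p, q, h, rfl⟩ := exists_eq_pair s
  let ρ : fixingSubgroup (SuzukiAut m) S →* RingAut (Fq m) :=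
    SemidirectProduct.rightHom.comp (Subgroup.subtype _)
  have hfix : ∀ (g : ρ.ker) (x), x ∈ S → (g : SuzukiAut m) • x = x := fun g x hx =>
    (mem_fixingSubgroup_iff _).mp g.1.2 x hx
  have hright : ∀ g : ρ.ker, (g : SuzukiAut m).right = 1 := fun g => g.2
  have hswap := fun g : ρ.ker => smul_pair_eq_pair_iff.mp (hfix g _ h1)
  have hker : Nat.card ρ.ker ≤ 2 := by
    classical
    -- an element of the kernel is determined by whether it fixes or swaps `p` and `q`
    have hinj : Function.Injective fun g : ρ.ker => decide ((g : SuzukiAut m) • p = p) := by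
      intro g g' hgg
      have hgg' : (g : SuzukiAut m) • p = p ↔ (g' : SuzukiAut m) • p = p := by simpa using hgg
      have hp : (g : SuzukiAut m) • p = (g' : SuzukiAut m) • p ∧
          (g : SuzukiAut m) • q = (g' : SuzukiAut m) • q := by
        rcases hswap g with ⟨ha, hb⟩ | ⟨ha, hb⟩ <;> rcases hswap g' with ⟨hc, hd⟩ | ⟨hc, hd⟩
        · rw [ha, hb, hc, hd]; exact ⟨rfl, rfl⟩
        · exact absurd (hc.symm.trans (hgg'.mp ha)) h.symm
        · exact absurd (ha.symm.trans (hgg'.mpr hc)) h.symm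
        · rw [ha, hb, hc, hd]; exact ⟨rfl, rfl⟩
      have := eq_one_of_fixes_of_smul_eq (g := ((g⁻¹ * g' : ρ.ker) : SuzukiAut m)) (hright _) hs
        (by simp [mul_smul, inv_smul_eq_iff, hp.1]) (by simp [mul_smul, inv_smul_eq_iff, hp.2])
        (hfix _ _ h2)
      exact inv_mul_eq_one.mp (Subtype.ext (Subtype.ext this))
    simpa using Nat.card_le_card_of_injective _ hinj
  rw [← Subgroup.card_mul_index ρ.ker, Subgroup.index_ker]
  refine mul_dvd_mul ?_ ((Subgroup.card_subgroup_dvd_card ρ.range).trans card_ringAut.dvd)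
  have : 0 < Nat.card ρ.ker := Nat.card_pos
  interval_cases Nat.card ρ.ker <;> norm_num

theorem le_of_isIrredundantBase {ℓ : ℕ} {ω : Fin ℓ → OvoidPairs m}
    (h : IsIrredundantBase (SuzukiAut m) ω) : ℓ ≤ 3 + cardFactors (2 * m + 1) := by
  by_cases hℓ : ℓ < 2
  · omega
  push Not at hℓ
  have hne : ω ⟨0, by omega⟩ ≠ ω ⟨1, by omega⟩ := by
    intro he
    obtain ⟨g, h1, h2⟩ := (isIrredundantBase_iff.mp h).1 ⟨1, by omega⟩
    exact h2 (he ▸ h1 ⟨0, by omega⟩ (by simp [Fin.lt_def]))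
  have h1 := h.le_cardFactors hℓ
  obtain ⟨c, hc⟩ := card_fixingSubgroup_dvd hne (S := ω '' {j | j.val < 2})
    ⟨_, by simp, rfl⟩ ⟨_, by simp, rfl⟩
  have h2 : cardFactors (2 * (2 * m + 1)) = 1 + cardFactors (2 * m + 1) := by
    rw [cardFactors_mul (by omega) (by omega), cardFactors_apply_prime Nat.prime_two]
  have hc0 : c ≠ 0 := by
    rintro rfl
    omega
  rw [hc, cardFactors_mul Nat.card_pos.ne' hc0] at h2
  omega

theorem none_ne_some_origin : (none : Ovoid m) ≠ some (origin m) := nofun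

theorem w_ne_one : w m ≠ 1 := fun h => by
  have := Equiv.congr_fun h none
  simp at this

theorem two_le_of_isIrredundantBase {ℓ : ℕ} {ω : Fin ℓ → OvoidPairs m}
    (h : IsIrredundantBase (SuzukiAut m) ω) : 2 ≤ ℓ := by
  by_contra! hℓ
  -- the stabilizer of a pair contains an involution of `G₀` that swaps its two points
  have key : ∀ s : OvoidPairs m, ∃ g : SuzukiAut m, g ≠ 1 ∧ g • s = s := by
    intro s
    obtain ⟨p, q, hpq, rfl⟩ := exists_eq_pair s
    obtain ⟨x, hx, hp, hq⟩ := exists_map_none_origin hpq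
    refine ⟨SemidirectProduct.inl ⟨x⁻¹ * w m * x, mul_mem (mul_mem (inv_mem hx) w_mem) hx⟩,
      fun h1 => ?_, ?_⟩
    · have h2 := congrArg Subtype.val (SemidirectProduct.inl_injective (h1.trans (map_one _).symm))
      exact w_ne_one (by simpa using conj_eq_one_iff (a := x⁻¹) |>.mp (by simpa using h2))
    · rw [smul_pair_eq_pair_iff, inl_smul, inl_smul]
      refine .inr ⟨?_, ?_⟩ <;> simp [hp, hq, Equiv.symm_apply_eq]
  have htriv := (isIrredundantBase_iff.mp h).2
  interval_cases ℓ
  · obtain ⟨g, hg, -⟩ := key (pair _ _ none_ne_some_origin)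
    exact hg (htriv g fun i => i.elim0)
  · obtain ⟨g, hg, hgs⟩ := key (ω 0)
    exact hg (htriv g fun i => by rwa [Subsingleton.elim i 0])

/-! ### Construction of irredundant bases -/

/-- The point of the ovoid with first two coordinates `x` and `y`. -/
noncomputable def point (x y : Fq m) : Ovoid m := some ⟨x, y, _, rfl⟩

theorem point_eq_point_iff {x y x' y' : Fq m} : point x y = point x' y' ↔ x = x' ∧ y = y' :=
  ⟨fun h => ⟨congrArg AffinePoint.x (Option.some.inj h),
      congrArg AffinePoint.y (Option.some.inj h)⟩,
    fun h => by rw [h.1, h.2]⟩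

theorem none_ne_point (x y : Fq m) : (none : Ovoid m) ≠ point x y := nofun

theorem some_origin : some (origin m) = point 0 0 := congrArg some (AffinePoint.ext' rfl rfl)

theorem t_point_zero (a b : Fq m) : t a b (point 0 0) = point a b :=
  congrArg some (AffinePoint.ext' (by simp [tFun]) (by simp [tFun]))

theorem n_point (γ : (Fq m)ˣ) (x y : Fq m) :
    n γ (point x y) = point (γ * x : Fq m) (sigma m γ * γ * y) :=
  congrArg some (AffinePoint.ext' rfl rfl)

theorem fieldPerm_none (φ : RingAut (Fq m)) : fieldPerm m φ none = none := rfl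

theorem fieldPerm_point (φ : RingAut (Fq m)) (x y : Fq m) :
    fieldPerm m φ (point x y) = point (φ x) (φ y) :=
  congrArg some (AffinePoint.ext' rfl rfl)

theorem w_point_one_zero : w m (point 1 0) = point 0 1 := by
  have hz : (⟨1, 0, _, rfl⟩ : AffinePoint m).z = 1 := by simp
  rw [point, w_some _ (by rw [hz]; exact one_ne_zero)]
  refine congrArg some (AffinePoint.ext' ?_ ?_) <;> simp [wAffine]

/-- The pair `{∞, 0}`. -/
noncomputable def basePair (m : ℕ) : OvoidPairs m := pair none (point 0 0) (none_ne_point _ _)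

/-- The pair `{∞, (1, y)}`. -/
noncomputable def infPair (y : Fq m) : OvoidPairs m := pair none (point 1 y) (none_ne_point _ _)

/-- The pair `{(1, 0), (0, 1)}`, whose two points are rational over the prime field and are swapped
by `w`. -/
noncomputable def swapPair (m : ℕ) : OvoidPairs m :=
  pair (point 1 0) (point 0 1) fun h => one_ne_zero (point_eq_point_iff.mp h).1

theorem t_smul_basePair_ne :
    (SemidirectProduct.inl ⟨t 1 0, t_mem 1 0⟩ : SuzukiAut m) • basePair m ≠ basePair m := by
  simp [basePair, smul_pair_eq_pair_iff, inl_smul, t_point_zero, point_eq_point_iff, none_ne_point]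

theorem n_smul_basePair (γ : (Fq m)ˣ) :
    (SemidirectProduct.inl ⟨n γ, n_mem γ⟩ : SuzukiAut m) • basePair m = basePair m := by
  simp [basePair, smul_pair_eq_pair_iff, inl_smul, n_point]

theorem n_smul_swapPair_ne {γ : (Fq m)ˣ} (hγ : γ ≠ 1) :
    (SemidirectProduct.inl ⟨n γ, n_mem γ⟩ : SuzukiAut m) • swapPair m ≠ swapPair m := by
  simp [swapPair, smul_pair_eq_pair_iff, inl_smul, n_point, point_eq_point_iff, hγ]

theorem w_smul_basePair :
    (SemidirectProduct.inl ⟨w m, w_mem⟩ : SuzukiAut m) • basePair m = basePair m := by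
  simp [basePair, smul_pair_eq_pair_iff, inl_smul, ← some_origin]

theorem w_smul_swapPair :
    (SemidirectProduct.inl ⟨w m, w_mem⟩ : SuzukiAut m) • swapPair m = swapPair m := by
  have h : w m (point 0 1) = point 1 0 := by rw [← w_point_one_zero, w_w]
  simp [swapPair, smul_pair_eq_pair_iff, inl_smul, w_point_one_zero, h]

theorem w_smul_infPair_ne (y : Fq m) :
    (SemidirectProduct.inl ⟨w m, w_mem⟩ : SuzukiAut m) • infPair y ≠ infPair y := by
  simp [infPair, smul_pair_eq_pair_iff, inl_smul, some_origin, point_eq_point_iff,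
    (none_ne_point _ _).symm]

theorem inr_smul_basePair (φ : RingAut (Fq m)) :
    (SemidirectProduct.inr φ : SuzukiAut m) • basePair m = basePair m := by
  simp [basePair, smul_pair_eq_pair_iff, inr_smul, fieldPerm_none, fieldPerm_point]

theorem inr_smul_swapPair (φ : RingAut (Fq m)) :
    (SemidirectProduct.inr φ : SuzukiAut m) • swapPair m = swapPair m := by
  simp [swapPair, smul_pair_eq_pair_iff, inr_smul, fieldPerm_point]

theorem inr_smul_infPair_iff (φ : RingAut (Fq m)) (y : Fq m) :
    (SemidirectProduct.inr φ : SuzukiAut m) • infPair y = infPair y ↔ φ y = y := by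
  simp [infPair, smul_pair_eq_pair_iff, inr_smul, fieldPerm_none, fieldPerm_point, none_ne_point,
    point_eq_point_iff]

/-- The pairs `{∞, 0}` and `{∞, (1, y)}` determine the points `∞`, `0` and `(1, y)`, so that only
field automorphisms fixing `y` stabilize both. -/
theorem left_eq_one_and_right_apply_eq {g : SuzukiAut m} {y : Fq m}
    (h1 : g • basePair m = basePair m) (h2 : g • infPair y = infPair y) :
    g.left = 1 ∧ g.right y = y := by
  rw [basePair, smul_pair_eq_pair_iff] at h1
  rw [infPair, smul_pair_eq_pair_iff] at h2
  have hinf : g • (none : Ovoid m) = none := by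
    rcases h1 with ⟨h1, -⟩ | ⟨h1, -⟩
    · exact h1
    · rcases h2 with ⟨h2, -⟩ | ⟨h2, -⟩
      · exact h2
      · exact absurd (point_eq_point_iff.mp (h1.symm.trans h2)).1 zero_ne_one
  have h0 : g • point 0 0 = (point 0 0 : Ovoid m) :=
    (h1.resolve_right fun h => none_ne_point 0 0 (hinf.symm.trans h.1)).2
  have hy : g • point 1 y = point 1 y :=
    (h2.resolve_right fun h => none_ne_point 1 y (hinf.symm.trans h.1)).2
  rw [smul_def, fieldPerm_none] at hinf
  rw [smul_def, fieldPerm_point, _root_.map_zero] at h0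
  rw [smul_def, fieldPerm_point, map_one] at hy
  obtain ⟨γ, hγ⟩ := eq_n_of_fixes g.left.2 hinf (some_origin ▸ h0)
  rw [hγ, n_point, point_eq_point_iff, mul_one] at hy
  have h1 : γ = 1 := Units.ext hy.1
  refine ⟨Subtype.ext (by rw [hγ, h1, n_one]; rfl), ?_⟩
  simpa [h1] using hy.2

theorem eq_one_of_smul_basePair_of_smul_infPair {y : Fq m}
    (hy : ∀ φ : RingAut (Fq m), φ y = y → φ = 1) {g : SuzukiAut m}
    (h1 : g • basePair m = basePair m) (h2 : g • infPair y = infPair y) : g = 1 := by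
  obtain ⟨hl, hr⟩ := left_eq_one_and_right_apply_eq h1 h2
  exact SemidirectProduct.ext hl (hy _ hr)

/-- The pairs `{∞, 0}, {∞, (1, y₀)}, …, {∞, (1, y_k)}`, with the `y_i` of `exists_chain_field`, form
an irredundant base. -/
theorem exists_isIrredundantBase {k : ℕ} (hk : k ≤ cardFactors (2 * m + 1)) :
    ∃ ω : Fin (k + 2) → OvoidPairs m, IsIrredundantBase (SuzukiAut m) ω := by
  obtain ⟨y, hy, hlast⟩ := exists_chain_field hk
  refine ⟨Fin.cons (basePair m) fun i => infPair (y i), isIrredundantBase_iff.mpr ⟨?_, ?_⟩⟩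
  · refine Fin.cases ?_ (Fin.cases ?_ fun i => ?_)
    · exact ⟨_, fun j hj => absurd hj (Fin.not_lt_zero j), t_smul_basePair_ne⟩
    · refine ⟨_, Fin.cases (fun _ => w_smul_basePair) fun j hj => ?_, w_smul_infPair_ne _⟩
      exact absurd (Fin.succ_lt_succ_iff.mp hj) (Fin.not_lt_zero j)
    · obtain ⟨φ, h1, h2⟩ := hy i
      refine ⟨.inr φ, Fin.cases (fun _ => inr_smul_basePair φ) fun j hj => ?_,
        fun h => h2 ((inr_smul_infPair_iff φ _).mp h)⟩
      refine (inr_smul_infPair_iff φ _).mpr (h1 j ?_)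
      exact Fin.le_castSucc_iff.mpr (Fin.succ_lt_succ_iff.mp hj)
  · intro g hg
    exact eq_one_of_smul_basePair_of_smul_infPair hlast (hg 0) (hg (Fin.last k).succ)

theorem exists_unit_ne_one (hm : 1 ≤ m) : ∃ γ : (Fq m)ˣ, γ ≠ 1 := by
  have hc : 2 < Nat.card (Fq m) := by
    rw [GaloisField.card 2 _ (by omega)]
    calc 2 = 2 ^ 1 := rfl
      _ < 2 ^ (2 * m + 1) := Nat.pow_lt_pow_right (by omega) (by omega)
  have hu : 1 < Nat.card (Fq m)ˣ := by
    rw [Nat.card_units]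
    omega
  have := Finite.one_lt_card_iff_nontrivial.mp hu
  exact exists_ne 1

/-- The base of `exists_isIrredundantBase` remains irredundant when `{(1, 0), (0, 1)}` is inserted
in the second place. The strictness there needs some `γ ≠ 1`, hence `q > 2`. -/
theorem exists_isIrredundantBase_add (hm : 1 ≤ m) {k : ℕ} (hk : k ≤ cardFactors (2 * m + 1)) :
    ∃ ω : Fin (k + 3) → OvoidPairs m, IsIrredundantBase (SuzukiAut m) ω := by
  obtain ⟨y, hy, hlast⟩ := exists_chain_field hk
  obtain ⟨γ, hγ⟩ := exists_unit_ne_one hm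
  refine ⟨Fin.cons (basePair m) (Fin.cons (swapPair m) fun i => infPair (y i)),
    isIrredundantBase_iff.mpr ⟨?_, ?_⟩⟩
  · refine Fin.cases ?_ (Fin.cases ?_ (Fin.cases ?_ fun i => ?_))
    · exact ⟨_, fun j hj => absurd hj (Fin.not_lt_zero j), t_smul_basePair_ne⟩
    · refine ⟨_, Fin.cases (fun _ => n_smul_basePair γ) fun j hj => ?_, n_smul_swapPair_ne hγ⟩
      exact absurd (Fin.succ_lt_succ_iff.mp hj) (Fin.not_lt_zero j)
    · refine ⟨_, Fin.cases (fun _ => w_smul_basePair) (Fin.cases (fun _ => w_smul_swapPair)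
        fun j hj => ?_), w_smul_infPair_ne _⟩
      exact absurd (Fin.succ_lt_succ_iff.mp (Fin.succ_lt_succ_iff.mp hj)) (Fin.not_lt_zero j)
    · obtain ⟨φ, h1, h2⟩ := hy i
      refine ⟨.inr φ, Fin.cases (fun _ => inr_smul_basePair φ)
        (Fin.cases (fun _ => inr_smul_swapPair φ) fun j hj => ?_),
        fun h => h2 ((inr_smul_infPair_iff φ _).mp h)⟩
      refine (inr_smul_infPair_iff φ _).mpr (h1 j ?_)
      exact Fin.le_castSucc_iff.mpr (Fin.succ_lt_succ_iff.mp (Fin.succ_lt_succ_iff.mp hj))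
  · intro g hg
    exact eq_one_of_smul_basePair_of_smul_infPair hlast (hg 0) (hg (Fin.last k).succ.succ)

end Suzuki

theorem mainTheorem2 (m : ℕ) (hm : 1 ≤ m) :
    irredundantBaseSizes (Suzuki.SuzukiAut m) (Suzuki.OvoidPairs m) =
      Set.Icc 2 (3 + ArithmeticFunction.cardFactors (2 * m + 1)) := by
  ext ℓ
  rw [Set.mem_Icc]
  constructor
  · rintro ⟨ω, h⟩
    exact ⟨Suzuki.two_le_of_isIrredundantBase h, Suzuki.le_of_isIrredundantBase h⟩
  · rintro ⟨h2, h3⟩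
    obtain ⟨k, rfl⟩ := Nat.exists_eq_add_of_le' h2
    by_cases hk : k ≤ cardFactors (2 * m + 1)
    · exact Suzuki.exists_isIrredundantBase hk
    · obtain rfl : k = cardFactors (2 * m + 1) + 1 := by omega
      exact Suzuki.exists_isIrredundantBase_add hm le_rfl
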